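/- Let $\mathbb F_2$ be the free group on two generators with word metric $d$ and word length $\ell(g)=d(1,g)$ for the standard generating set. For a Markov chain on a group $G$ with transition probabilities $p(g,h)$, write $w_n^x$ for its position at time $n$ when started at $x$. The chain is \emph{tame} if: (i) there is a finite $S\subseteq G$ with $p(g,h)=0$ whenever $h\notin gS$; (ii) there are $B>0$, $\rho<1$ with $\mathbb P[w_n^x=y]\le B\rho^n$ for all $x,y\in G$, $n\ge 0$; (iii) for every $u\in G$ there are $\epsilon_u,K_u>0$ such that for every $g\in G$ one has $\mathbb P[w_k^g=gu]\ge\epsilon_u$ for some $k\le K_u$. A chain on $\mathbb F_2$ started at $p$ has \emph{well-defined drift} $L$ if $\mathbb E[d(p,w_n^p)]/n\to L\in\mathbb R$; it then satisfies a \emph{Central Limit Theorem} if for some $\sigma>0$ the variables $(d(p,w_n^p)-Ln)/(\sigma^2\sqrt n)$ converge in distribution to $\mathcal N(0,1)$. Given $\lambda_j\in[0,1]$ for $j\geq 1$, the \emph{length-homogeneous} chain on $\mathbb F_2$ with backtracking probabilities $(\lambda_j)$ is the chain which moves from $1$ to each of its four neighbours in the Cayley graph with probability $1/4$, and from $g\ne1$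 to its unique neighbour of length $\ell(g)-1$ with probability $\lambda_{\ell(g)}$ and to each of its three neighbours of length $\ell(g)+1$ with probability $(1-\lambda_{\ell(g)})/3$. \textbf{Theorem A.} There exist tame Markov chains on $\mathbb F_2$ without well-defined drift, and tame Markov chains on $\mathbb F_2$ with well-defined drift that do not satisfy a Central Limit Theorem. More precisely: (1) Let $0<\lambda<1/4$, $N_{-1}=-1$ and $N_s=2^{s^2}$ for integers $s\ge0$. The length-homogeneous chain with $\lambda_j=\lambda$ if $j\in(N_{s-1},N_s]$ for an odd $s\ge 0$, and $\lambda_j=\lambda/2$ if $j\in(N_{s-1},N_s]$ for an even $s\ge 0$, is tame, and for every starting point $p\in\mathbb F_2$ it does not have well-defined drift. (2) Let $0<\lambda<1/4$, let $N_1>2^6$ be an integer, $N_s=4^{s-1}N_1$ for $s\ge1$, and $B=\mathbb N\cap\bigcup_{s\ge1}\left[\tfrac12N_s-N_s^{5/6},\tfrac12N_s+N_s^{5/6}\right]$. The length-homogeneous chain with $\lambda_j=\lambda$ if $j\in B$ and $\lambda_j=1/4$ otherwise is tame, and for every starting point $p\in\mathbb F_2$ it has well-defined drift $1/2$ and does not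 satisfy a Central Limit Theorem. -/

import Mathlib

open Filter Topology MeasureTheory ProbabilityTheory
open scoped ENNReal NNReal Pointwise

noncomputable section

/-! ### Markov chains on a countable state space and on groups -/

/-- A (time-homogeneous) Markov chain on `G` is given by its one-step transition probabilities
`P : G → PMF G`, `P g h = p(g,h)`.  `stepLaw P x n` is the law of the position `w_n^x` at time `n`
of the chain started at `x`; so `stepLaw P x n y` is `ℙ[w_n^x = y]`. -/
def stepLaw {G : Type*} (P : G → PMF G) (x : G) : ℕ → PMF G
  | 0 => PMF.pure x
  | n + 1 => (stepLaw P x n).bind P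

/-- Tame Markov chains on a group. -/
structure IsTame {G : Type*} [Group G] (P : G → PMF G) : Prop where
  /-- Bounded jumps. -/
  bounded_jumps : ∃ S : Set G, S.Finite ∧ ∀ g h : G, h ∉ g • S → P g h = 0
  /-- Non-amenability. -/
  non_amenability : ∃ B ρ : ℝ, 0 < B ∧ ρ < 1 ∧
    ∀ (x y : G) (n : ℕ), (stepLaw P x n y).toReal ≤ B * ρ ^ n
  /-- Irreducibility. -/
  irreducibility : ∀ u : G, ∃ (ε : ℝ) (K : ℕ), 0 < ε ∧ 0 < K ∧
    ∀ g : G, ∃ k : ℕ, k ≤ K ∧ ε ≤ (stepLaw P g k (g * u)).toReal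

/-! ### The free group of rank two with its standard word metric -/

/-- The free group on two generators. -/
abbrev F2 : Type := FreeGroup (Fin 2)

/-- The word metric of the standard generating set (the distance in the Cayley graph); the standard
length is `ℓ(g) = d(1,g) = g.norm`. -/
def wordDist (g h : F2) : ℕ := (g⁻¹ * h).norm

/-- The expectation `𝔼[d(p, w_n^p)]`. -/
def expectedDist (P : F2 → PMF F2) (p : F2) (n : ℕ) : ℝ≥0∞ :=
  ∑' h : F2, stepLaw P p n h * (wordDist p h : ℝ≥0∞)

/-- The chain started at `p` has well-defined drift, with value `L`:
`𝔼[d(p, w_n^p)] / n` converges to the (finite) number `L`. -/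
def HasDrift (P : F2 → PMF F2) (p : F2) (L : ℝ≥0) : Prop :=
  Tendsto (fun n : ℕ => expectedDist P p n / (n : ℝ≥0∞)) atTop (𝓝 (L : ℝ≥0∞))

/-- The law on `ℝ` of `(d(p, w_n^p) - L n) / (σ² √n)`. -/
def normalizedLaw (P : F2 → PMF F2) (p : F2) (L σ : ℝ) (n : ℕ) : ProbabilityMeasure ℝ :=
  ⟨((stepLaw P p n).map
      (fun h => ((wordDist p h : ℝ) - L * n) / (σ ^ 2 * Real.sqrt n))).toMeasure,
    inferInstance⟩

/-- The standard normal distribution `𝒩(0,1)`. -/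
def stdGaussian : ProbabilityMeasure ℝ := ⟨gaussianReal 0 1, inferInstance⟩

/-- The Central Limit Theorem for the chain started at `p`, where `L` is its drift: for some
`σ > 0`, `(d(p, w_n^p) - L n) / (σ² √n)` converges in distribution to `𝒩(0,1)`. -/
def SatisfiesCLT (P : F2 → PMF F2) (p : F2) (L : ℝ) : Prop :=
  ∃ σ : ℝ, 0 < σ ∧ Tendsto (normalizedLaw P p L σ) atTop (𝓝 stdGaussian)

/-! ### Length-homogeneous chains -/

open Classical in
/-- The transition probabilities with backtracking probabilities `lam g`: from the identity each of
the four neighbours has probability `1/4`; from `g ≠ 1` the unique neighbour closer to the identity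
has probability `lam g`, and each of the three others `(1 - lam g) / 3`. -/
def transitionProb (lam : F2 → ℝ) (g h : F2) : ℝ :=
  if wordDist g h = 1 then
    if g = 1 then 1 / 4
    else if h.norm + 1 = g.norm then lam g
    else if h.norm = g.norm + 1 then (1 - lam g) / 3
    else 0
  else 0

/-- `P` is the nearest-neighbour Markov chain on `F2` with backtracking probabilities `lam`. -/
def IsBacktrackingChain (lam : F2 → ℝ) (P : F2 → PMF F2) : Prop :=
  (∀ g, 0 ≤ lam g ∧ lam g ≤ 1) ∧
    ∀ g h, P g h = ENNReal.ofReal (transitionProb lam g h)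

/-- Length-homogeneous Markov chains: the backtracking probability depends only on the length. -/
def IsLengthHomogeneous (P : F2 → PMF F2) : Prop :=
  ∃ lam : F2 → ℝ, IsBacktrackingChain lam P ∧
    ∀ g₁ g₂ : F2, g₁.norm = g₂.norm → lam g₁ = lam g₂

open Classical in
/-- With `N_{-1} = -1` and `N_s = 2^(s^2)` for `s ≥ 0`, the annuli `(N_{s-1}, N_s]` partition `ℕ`.
The value at length `j` is `a` if `j` lies in an annulus with odd `s = 2 k + 1`, and `a / 2`
otherwise, that is, if `s` is even. -/
def alternatingProb (a : ℝ) (j : ℕ) : ℝ :=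
  if ∃ k : ℕ, 2 ^ ((2 * k) ^ 2) < j ∧ j ≤ 2 ^ ((2 * k + 1) ^ 2) then a else a / 2

/-- The union over `s ≥ 1` of the annuli `[N_s/2 - N_s^(5/6), N_s/2 + N_s^(5/6)] ∩ ℕ`,
where `N_s = 4^(s-1) N₁`. -/
def sparseAnnuli (N₁ : ℕ) : Set ℕ :=
  {j | ∃ k : ℕ,
    ((4 ^ k * N₁ : ℕ) : ℝ) / 2 - ((4 ^ k * N₁ : ℕ) : ℝ) ^ (5 / 6 : ℝ) ≤ (j : ℝ) ∧
    (j : ℝ) ≤ ((4 ^ k * N₁ : ℕ) : ℝ) / 2 + ((4 ^ k * N₁ : ℕ) : ℝ) ^ (5 / 6 : ℝ)}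

open Classical in
/-- Backtracking probability `a` on the sparse annuli and `1/4` elsewhere. -/
def sparseProb (N₁ : ℕ) (a : ℝ) (j : ℕ) : ℝ :=
  if j ∈ sparseAnnuli N₁ then a else 1 / 4

end

/-!
For a length-homogeneous chain the length `|w_n|` is a nearest-neighbour walk on `ℕ`, and all
expectations at time `n` are iterates of the averaging operator `avg` on functions on `F2`
(`IsBacktrackingChain.tsum_stepLaw`). The argument works with explicit test functions for `avg`.

*Tameness.* If all backtracking probabilities are at most `1 / 4`, then every neighbour is reached
with probability at most `1 / 3`. From `g ≠ y` only one neighbour is closer to `y`, so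
`(2 / 3) ^ d(·, y)` is multiplied by at most `(1 / 3) (3 / 2) + (2 / 3) (2 / 3) = 17 / 18` under
averaging (`avg_pow_wordDist_le`), which gives the uniform exponential bound on `ℙ[w_n^x = y]`.

*Hitting times.* Let `F x` be the expected time to reach length `x` from the identity (`hitTime`).
Then `F(|w_n|) - n` is a martingale with bounded increments, so its variance is at most `9 n`
(`iterate_avg_hitTime`, `iterate_avg_sq_hitTime_le`). If the backtracking probability is `μ`
at all but `C` of the lengths up to `x`, then `F x` is `x / (1 - 2 μ)` up to `O(1 + C)`
(`abs_hitTime_sub_le`); hence `𝔼 d(p, w_n)` is `(1 - 2 μ) n` up to `O(1 + C)`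
(`abs_expected_wordDist_sub_le`).

*Alternating annuli.* At time `2 ^ (t ^ 2 + 2 t)` the chain has not left the annulus
`(2 ^ t ^ 2, 2 ^ (t + 1) ^ 2]` on the outside, and the smaller lengths are a negligible proportion.
So `𝔼 d(p, w_n) / n` tends to `1 - 2 a` along even `t` and to `1 - a` along odd `t`.

*Sparse annuli.* The annuli contain `O(x ^ (5 / 6))` of the lengths up to `x`
(`exists_card_sparseAnnuli_le`), so the drift is `1 - 2 / 4 = 1 / 2`. On the other hand
`2 x - F x ≥ 0`, and this difference is at least a multiple of `N ^ (5 / 6)` once `x` is past the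
middle `N / 2` of an annulus. At time `2 N` the martingale property gives
`|w_n| ≥ n / 2 + c N ^ (5 / 6) - O(√N)` with probability close to `1`
(`eventually_sq_le_of_wordDist_lt` with Chebyshev's inequality). Thus the normalized variable is
negative with a probability that tends to `0` along these times, whereas a Gaussian limit would have
to give positive mass to the negative half-line.
-/

/-! ### Neighbours in the Cayley graph -/

/-- The element of `F2` spelled by a single letter; `(i, true)` stands for the `i`-th generator and
`(i, false)` for its inverse. -/
def gen (a : Fin 2 × Bool) : F2 := FreeGroup.mk [a]

lemma gen_injective : Function.Injective gen := by
  intro a b h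
  have := congrArg FreeGroup.toWord h
  simpa [gen, FreeGroup.toWord_mk, FreeGroup.reduce_singleton] using this

lemma norm_gen (a : Fin 2 × Bool) : (gen a).norm = 1 := by
  simp [gen, FreeGroup.norm, FreeGroup.toWord_mk]

lemma exists_gen_of_norm_eq_one {h : F2} (hh : h.norm = 1) : ∃ a, h = gen a := by
  obtain ⟨a, ha⟩ := List.length_eq_one_iff.1 hh
  exact ⟨a, by rw [gen, ← ha, FreeGroup.mk_toWord]⟩

lemma gen_inv (a : Fin 2 × Bool) : (gen a)⁻¹ = gen (a.1, !a.2) := by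
  simp [gen, FreeGroup.inv_mk, FreeGroup.invRev]

lemma norm_gen_mul (a : Fin 2 × Bool) (g : F2) :
    (gen a * g).norm =
      if g.toWord.head? = some (a.1, !a.2) then g.norm - 1 else g.norm + 1 := by
  have h : (gen a * g).toWord = FreeGroup.reduce (a :: g.toWord) := by
    conv_lhs => rw [← FreeGroup.mk_toWord (x := g), gen, FreeGroup.mul_mk, FreeGroup.toWord_mk]
    rfl
  rw [FreeGroup.norm, h, FreeGroup.reduce.cons, FreeGroup.reduce_toWord, FreeGroup.norm]
  rcases hw : g.toWord with _ | ⟨b, w⟩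
  · simp
  · have : (a.1 = b.1 ∧ a.2 = !b.2) ↔ b = (a.1, !a.2) := by
      rcases a with ⟨i, x⟩; rcases b with ⟨j, y⟩
      cases x <;> cases y <;> simp [eq_comm]
    by_cases hb : b = (a.1, !a.2)
    · simp [hb]
    · simp [this, hb]

/-- Multiplying a nontrivial element on the left by a letter shortens it for exactly one letter, and
lengthens it for the others. -/
lemma exists_norm_gen_mul {g : F2} (hg : g ≠ 1) :
    ∃ a₀, (gen a₀ * g).norm + 1 = g.norm ∧ ∀ a ≠ a₀, (gen a * g).norm = g.norm + 1 := by
  have hw : g.toWord ≠ [] := by simpa [FreeGroup.toWord_eq_nil_iff] using hg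
  obtain ⟨b, w, hbw⟩ := List.exists_cons_of_ne_nil hw
  refine ⟨(b.1, !b.2), ?_, fun a ha => ?_⟩
  · rw [norm_gen_mul, hbw, if_pos (by simp), FreeGroup.norm, hbw]
    simp
  · rw [norm_gen_mul, hbw, if_neg]
    rintro h
    apply ha
    have : b = (a.1, !a.2) := by simpa using h
    simp [this]

lemma exists_norm_mul_gen {g : F2} (hg : g ≠ 1) :
    ∃ a₀, (g * gen a₀).norm + 1 = g.norm ∧ ∀ a ≠ a₀, (g * gen a).norm = g.norm + 1 := by
  have key : ∀ a, (g * gen a).norm = (gen (a.1, !a.2) * g⁻¹).norm := fun a => by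
    rw [← FreeGroup.norm_inv_eq, mul_inv_rev, gen_inv]
  obtain ⟨a₀, h₀, h⟩ := exists_norm_gen_mul (inv_ne_one.2 hg)
  rw [FreeGroup.norm_inv_eq] at h₀ h
  refine ⟨(a₀.1, !a₀.2), ?_, fun a ha => ?_⟩
  · rw [key]; simpa using h₀
  · rw [key]
    refine h _ fun h' => ha ?_
    simp [← h']

lemma wordDist_eq_one_iff {g h : F2} : wordDist g h = 1 ↔ ∃ a, h = g * gen a := by
  constructor
  · intro hh
    obtain ⟨a, ha⟩ := exists_gen_of_norm_eq_one hh
    exact ⟨a, by rw [← ha]; group⟩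
  · rintro ⟨a, rfl⟩
    simp [wordDist, norm_gen]

lemma norm_mul_gen_le (g : F2) (a : Fin 2 × Bool) : (g * gen a).norm ≤ g.norm + 1 :=
  (FreeGroup.norm_mul_le _ _).trans (by rw [norm_gen])

lemma norm_le_wordDist_add (p h : F2) : h.norm ≤ wordDist p h + p.norm := by
  have := FreeGroup.norm_mul_le p (p⁻¹ * h)
  rw [mul_inv_cancel_left] at this
  rw [wordDist]; omega

lemma wordDist_le_norm_add (p h : F2) : wordDist p h ≤ h.norm + p.norm := by
  have := FreeGroup.norm_mul_le p⁻¹ h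
  rw [FreeGroup.norm_inv_eq] at this
  rw [wordDist]; omega

/-! ### The one-step averaging operator -/

lemma transitionProb_mul_gen (lam : F2 → ℝ) (g : F2) (a : Fin 2 × Bool) :
    transitionProb lam g (g * gen a) =
      if g = 1 then 1 / 4
      else if (g * gen a).norm + 1 = g.norm then lam g else (1 - lam g) / 3 := by
  rw [transitionProb, if_pos (wordDist_eq_one_iff.2 ⟨a, rfl⟩)]
  by_cases hg : g = 1
  · simp [hg]
  · rw [if_neg hg, if_neg hg]
    by_cases h : (g * gen a).norm + 1 = g.norm
    · simp [h]
    · rw [if_neg h, if_neg h, if_pos]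
      obtain ⟨a₀, h₀, h'⟩ := exists_norm_mul_gen hg
      exact h' a fun e => h (e ▸ h₀)

/-- The averaging operator of the chain with backtracking probabilities `lam`: `avg lam f g` is the
expectation of `f` after one step from `g`. -/
noncomputable def avg (lam : F2 → ℝ) (f : F2 → ℝ) (g : F2) : ℝ :=
  ∑ a, transitionProb lam g (g * gen a) * f (g * gen a)

lemma sum_eq_of_letter (f : Fin 2 × Bool → ℝ) (a₀ : Fin 2 × Bool) (c : ℝ)
    (h : ∀ a ≠ a₀, f a = c) : ∑ a, f a = f a₀ + 3 * c := by
  rw [← Finset.add_sum_erase _ _ (Finset.mem_univ a₀),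
    Finset.sum_congr rfl (fun a ha => h a (Finset.ne_of_mem_erase ha))]
  simp

lemma avg_norm_of_ne_one (lam : F2 → ℝ) (φ : ℕ → ℝ) {g : F2} (hg : g ≠ 1) :
    avg lam (fun h => φ h.norm) g =
      lam g * φ (g.norm - 1) + (1 - lam g) * φ (g.norm + 1) := by
  obtain ⟨a₀, h₀, h⟩ := exists_norm_mul_gen hg
  rw [avg, sum_eq_of_letter _ a₀ ((1 - lam g) / 3 * φ (g.norm + 1))]
  · rw [transitionProb_mul_gen, if_neg hg, if_pos h₀, ← h₀]
    simp only [Nat.add_sub_cancel]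
    ring
  · intro a ha
    rw [transitionProb_mul_gen, if_neg hg, h a ha, if_neg (by omega)]

lemma avg_norm_one (lam : F2 → ℝ) (φ : ℕ → ℝ) : avg lam (fun h => φ h.norm) 1 = φ 1 := by
  simp_rw [avg, transitionProb_mul_gen, one_mul, norm_gen]
  simp

lemma avg_const (lam : F2 → ℝ) (c : ℝ) : avg lam (fun _ => c) = fun _ => c := by
  funext g
  by_cases hg : g = 1
  · subst hg; exact avg_norm_one lam fun _ => c
  · rw [avg_norm_of_ne_one lam (fun _ => c) hg]; ring

lemma sum_transitionProb (lam : F2 → ℝ) (g : F2) :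
    ∑ a, transitionProb lam g (g * gen a) = 1 := by
  simpa [avg] using congrFun (avg_const lam 1) g

lemma avg_add (lam : F2 → ℝ) (f₁ f₂ : F2 → ℝ) :
    avg lam (fun h => f₁ h + f₂ h) = fun h => avg lam f₁ h + avg lam f₂ h := by
  funext g; simp [avg, mul_add, Finset.sum_add_distrib]

lemma avg_const_mul (lam : F2 → ℝ) (c : ℝ) (f : F2 → ℝ) :
    avg lam (fun h => c * f h) = fun h => c * avg lam f h := by
  funext g; simp only [avg, Finset.mul_sum]
  exact Finset.sum_congr rfl fun _ _ => by ring

lemma transitionProb_nonneg {lam : F2 → ℝ} (hl : ∀ g, 0 ≤ lam g ∧ lam g ≤ 1) (g h : F2) :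
    0 ≤ transitionProb lam g h := by
  have := hl g
  unfold transitionProb
  split_ifs <;> linarith

lemma iterate_avg_add (lam : F2 → ℝ) (f₁ f₂ : F2 → ℝ) (n : ℕ) (p : F2) :
    (avg lam)^[n] (fun h => f₁ h + f₂ h) p = (avg lam)^[n] f₁ p + (avg lam)^[n] f₂ p := by
  induction n generalizing f₁ f₂ with
  | zero => rfl
  | succ n ih => simp only [Function.iterate_succ_apply, avg_add, ih]

lemma iterate_avg_const_mul (lam : F2 → ℝ) (c : ℝ) (f : F2 → ℝ) (n : ℕ) (p : F2) :
    (avg lam)^[n] (fun h => c * f h) p = c * (avg lam)^[n] f p := by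
  induction n generalizing f with
  | zero => rfl
  | succ n ih => simp only [Function.iterate_succ_apply, avg_const_mul, ih]

lemma iterate_avg_const (lam : F2 → ℝ) (c : ℝ) (n : ℕ) (p : F2) :
    (avg lam)^[n] (fun _ => c) p = c := by
  rw [Function.iterate_fixed (avg_const lam c)]

/-- Comparison of expectations at time `n`: only the ball of radius `n` around the starting point
matters, and it lies in the ball of radius `‖p‖ + n` around the identity. -/
lemma iterate_avg_mono {lam : F2 → ℝ} (hl : ∀ g, 0 ≤ lam g ∧ lam g ≤ 1) {f₁ f₂ : F2 → ℝ}
    (n : ℕ) (p : F2) (h : ∀ g : F2, g.norm ≤ p.norm + n → f₁ g ≤ f₂ g) :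
    (avg lam)^[n] f₁ p ≤ (avg lam)^[n] f₂ p := by
  induction n generalizing p with
  | zero => exact h p (by simp)
  | succ n ih =>
    simp only [Function.iterate_succ_apply']
    refine Finset.sum_le_sum fun a _ => mul_le_mul_of_nonneg_left (ih _ fun g hg => h g ?_)
      (transitionProb_nonneg hl _ _)
    have := norm_mul_gen_le p a
    omega

lemma iterate_avg_nonneg {lam : F2 → ℝ} (hl : ∀ g, 0 ≤ lam g ∧ lam g ≤ 1) {f : F2 → ℝ}
    (hf : ∀ g, 0 ≤ f g) (n : ℕ) (p : F2) : 0 ≤ (avg lam)^[n] f p := by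
  have := iterate_avg_mono hl n p (f₁ := fun _ => 0) fun g _ => hf g
  rwa [iterate_avg_const] at this

lemma tsum_eq_sum_letter {F : F2 → ℝ≥0∞} (g : F2) (hF : ∀ h, wordDist g h ≠ 1 → F h = 0) :
    ∑' h, F h = ∑ a, F (g * gen a) := by
  have hinj : Function.Injective fun a => g * gen a :=
    (mul_right_injective g).comp gen_injective
  rw [← tsum_fintype (L := SummationFilter.unconditional _), ← hinj.tsum_eq (f := F)]
  intro h hh
  by_contra hc
  refine hh (hF h fun h1 => hc ?_)
  obtain ⟨a, rfl⟩ := wordDist_eq_one_iff.1 h1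
  exact ⟨a, rfl⟩

lemma exists_isBacktrackingChain {lam : F2 → ℝ} (hl : ∀ g, 0 ≤ lam g ∧ lam g ≤ 1) :
    ∃ P, IsBacktrackingChain lam P := by
  have hsum : ∀ g, ∑' h, ENNReal.ofReal (transitionProb lam g h) = 1 := fun g => by
    rw [tsum_eq_sum_letter g fun h hh => by simp [transitionProb, hh],
      ← ENNReal.ofReal_sum_of_nonneg fun a _ => transitionProb_nonneg hl _ _,
      sum_transitionProb, ENNReal.ofReal_one]
  exact ⟨fun g => ⟨fun h => ENNReal.ofReal (transitionProb lam g h),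
    hsum g ▸ ENNReal.summable.hasSum⟩, hl, fun g h => rfl⟩

lemma IsBacktrackingChain.tsum_mul {lam : F2 → ℝ} {P : F2 → PMF F2}
    (hP : IsBacktrackingChain lam P) {f : F2 → ℝ} (hf : ∀ g, 0 ≤ f g) (g : F2) :
    ∑' h, P g h * ENNReal.ofReal (f h) = ENNReal.ofReal (avg lam f g) := by
  rw [tsum_eq_sum_letter g fun h hh => by simp [hP.2, transitionProb, hh], avg,
    ENNReal.ofReal_sum_of_nonneg fun a _ =>
      mul_nonneg (transitionProb_nonneg hP.1 _ _) (hf _)]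
  refine Finset.sum_congr rfl fun a _ => ?_
  rw [hP.2, ENNReal.ofReal_mul (transitionProb_nonneg hP.1 _ _)]

/-- Expectations at time `n` are iterates of the averaging operator. -/
lemma IsBacktrackingChain.tsum_stepLaw {lam : F2 → ℝ} {P : F2 → PMF F2}
    (hP : IsBacktrackingChain lam P) {f : F2 → ℝ} (hf : ∀ g, 0 ≤ f g) (p : F2) (n : ℕ) :
    ∑' h, stepLaw P p n h * ENNReal.ofReal (f h) = ENNReal.ofReal ((avg lam)^[n] f p) := by
  induction n generalizing f with
  | zero =>
    rw [tsum_eq_single p fun h hh => by simp [stepLaw, hh]]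
    simp [stepLaw]
  | succ n ih =>
    have hf' : ∀ g, 0 ≤ avg lam f g := fun g => iterate_avg_nonneg hP.1 hf 1 g
    rw [Function.iterate_succ_apply, ← ih hf']
    simp only [stepLaw, PMF.bind_apply, ← ENNReal.tsum_mul_right, ← hP.tsum_mul hf]
    rw [ENNReal.tsum_comm]
    simp only [← ENNReal.tsum_mul_left, mul_assoc]

/-! ### Tameness -/

lemma transitionProb_mul_gen_le {lam : F2 → ℝ} (hl : ∀ g, 0 ≤ lam g ∧ lam g ≤ 1 / 4) (g : F2)
    (a : Fin 2 × Bool) : transitionProb lam g (g * gen a) ≤ 1 / 3 := by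
  have := hl g
  rw [transitionProb_mul_gen]
  split_ifs <;> linarith

/-- From `g ≠ y` only one neighbour is closer to `y`, and it is reached with probability at most
`1 / 3`. Hence `(2 / 3) ^ d(·, y)` contracts under averaging. -/
lemma avg_pow_wordDist_le {lam : F2 → ℝ} (hl : ∀ g, 0 ≤ lam g ∧ lam g ≤ 1 / 4) (y g : F2) :
    avg lam (fun h => (2 / 3 : ℝ) ^ wordDist h y) g ≤ 17 / 18 * (2 / 3 : ℝ) ^ wordDist g y := by
  have hd : ∀ a, wordDist (g * gen a) y = (gen (a.1, !a.2) * (g⁻¹ * y)).norm := fun a => by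
    rw [wordDist, mul_inv_rev, gen_inv, mul_assoc]
  have hs := sum_transitionProb lam g
  by_cases hg : g⁻¹ * y = 1
  · simp_rw [avg, hd, hg, mul_one, norm_gen, ← Finset.sum_mul, hs, wordDist, hg]
    norm_num [FreeGroup.norm_one]
  · obtain ⟨b, h₀, h⟩ := exists_norm_gen_mul hg
    set a₀ : Fin 2 × Bool := (b.1, !b.2) with ha₀
    have e₀ : wordDist (g * gen a₀) y + 1 = wordDist g y := by
      rw [hd, wordDist]; simpa [ha₀] using h₀
    have e : ∀ a ≠ a₀, wordDist (g * gen a) y = wordDist g y + 1 := fun a ha => by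
      rw [hd, wordDist]
      refine h _ fun h' => ha ?_
      rw [ha₀, ← h']; simp
    have hq := transitionProb_mul_gen_le hl g a₀
    rw [avg, ← Finset.add_sum_erase _ _ (Finset.mem_univ a₀), Finset.sum_congr rfl
      (fun a ha => by rw [e a (Finset.ne_of_mem_erase ha)]), ← Finset.sum_mul]
    rw [← Finset.add_sum_erase _ _ (Finset.mem_univ a₀)] at hs
    rw [eq_sub_of_add_eq' hs, ← e₀]
    have hpos : (0 : ℝ) < (2 / 3) ^ wordDist (g * gen a₀) y := by positivity
    rw [pow_succ, pow_succ]
    nlinarith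

lemma IsBacktrackingChain.stepLaw_le {lam : F2 → ℝ} {P : F2 → PMF F2}
    (hP : IsBacktrackingChain lam P) (hl : ∀ g, lam g ≤ 1 / 4) (x y : F2) (n : ℕ) :
    (stepLaw P x n y).toReal ≤ (17 / 18) ^ n := by
  have hl' : ∀ g, 0 ≤ lam g ∧ lam g ≤ 1 / 4 := fun g => ⟨(hP.1 g).1, hl g⟩
  have hiter : ∀ n x, (avg lam)^[n] (fun h => (2 / 3 : ℝ) ^ wordDist h y) x ≤ (17 / 18) ^ n := by
    intro n
    induction n with
    | zero => intro x; simpa using pow_le_one₀ (by norm_num) (by norm_num)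
    | succ n ih =>
      intro x
      rw [Function.iterate_succ_apply]
      refine (iterate_avg_mono hP.1 n x fun g _ => avg_pow_wordDist_le hl' y g).trans ?_
      rw [iterate_avg_const_mul, pow_succ']
      exact mul_le_mul_of_nonneg_left (ih x) (by norm_num)
  refine ENNReal.toReal_le_of_le_ofReal (by positivity)
    (le_trans ?_ (ENNReal.ofReal_le_ofReal (hiter n x)))
  rw [← hP.tsum_stepLaw (fun g => by positivity)]
  refine le_trans ?_ (ENNReal.le_tsum y)
  simp [wordDist, FreeGroup.norm_one]

lemma IsBacktrackingChain.le_stepLaw {lam : F2 → ℝ} {P : F2 → PMF F2}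
    (hP : IsBacktrackingChain lam P) {ε : ℝ} (hε : 0 < ε)
    (hl : ∀ g, ε ≤ lam g ∧ lam g ≤ 1 / 4) (w : List (Fin 2 × Bool)) (g : F2) :
    ENNReal.ofReal (ε ^ w.length) ≤ stepLaw P g w.length (g * FreeGroup.mk w) := by
  have hstep : ∀ g a, ENNReal.ofReal ε ≤ P g (g * gen a) := fun g a => by
    rw [hP.2, transitionProb_mul_gen]
    refine ENNReal.ofReal_le_ofReal ?_
    have := hl g
    split_ifs <;> linarith
  induction w using List.reverseRecOn with
  | nil => simp [stepLaw, ← FreeGroup.one_eq_mk]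
  | append_singleton w a ih =>
    have e : g * FreeGroup.mk (w ++ [a]) = g * FreeGroup.mk w * gen a := by
      rw [gen, mul_assoc, FreeGroup.mul_mk]
    rw [List.length_append, List.length_singleton, pow_succ,
      ENNReal.ofReal_mul (by positivity), e, stepLaw, PMF.bind_apply]
    exact (mul_le_mul' ih (hstep _ a)).trans
      (ENNReal.le_tsum (f := fun h => stepLaw P g w.length h * P h (g * FreeGroup.mk w * gen a)) _)

theorem IsBacktrackingChain.isTame {lam : F2 → ℝ} {P : F2 → PMF F2}
    (hP : IsBacktrackingChain lam P) {ε : ℝ} (hε : 0 < ε)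
    (hl : ∀ g, ε ≤ lam g ∧ lam g ≤ 1 / 4) : IsTame P where
  bounded_jumps := by
    refine ⟨Set.range gen, Set.finite_range _, fun g h hh => ?_⟩
    rw [hP.2, transitionProb, if_neg, ENNReal.ofReal_zero]
    rw [wordDist_eq_one_iff]
    rintro ⟨a, rfl⟩
    exact hh ⟨gen a, ⟨a, rfl⟩, rfl⟩
  non_amenability := ⟨1, 17 / 18, one_pos, by norm_num, fun x y n => by
    rw [one_mul]; exact hP.stepLaw_le (fun g => (hl g).2) x y n⟩
  irreducibility := fun u => by
    refine ⟨ε ^ u.norm, u.norm + 1, by positivity, by omega, fun g => ⟨u.norm, by omega, ?_⟩⟩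
    have := hP.le_stepLaw hε hl u.toWord g
    rw [FreeGroup.mk_toWord] at this
    exact (ENNReal.ofReal_le_iff_le_toReal (PMF.apply_ne_top _ _)).1 this

/-! ### Hitting times of levels -/

/-- The expected time which the length-homogeneous chain with backtracking probabilities `ℓ` needs
to get from length `x` to length `x + 1`, given by the recursion `D 0 = 1`,
`(1 - ℓ x) D x = 1 + ℓ x D (x - 1)`. -/
noncomputable def crossTime (ℓ : ℕ → ℝ) : ℕ → ℝ
  | 0 => 1
  | x + 1 => (1 + ℓ (x + 1) * crossTime ℓ x) / (1 - ℓ (x + 1))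

/-- The expected time to get from the identity to length `x`. -/
noncomputable def hitTime (ℓ : ℕ → ℝ) (x : ℕ) : ℝ := ∑ j ∈ Finset.range x, crossTime ℓ j

section

variable {ℓ : ℕ → ℝ}

lemma one_sub_mul_crossTime_succ (hl : ∀ j, 0 ≤ ℓ j ∧ ℓ j ≤ 1 / 4) (x : ℕ) :
    (1 - ℓ (x + 1)) * crossTime ℓ (x + 1) = 1 + ℓ (x + 1) * crossTime ℓ x := by
  rw [crossTime, mul_div_cancel₀]
  linarith [hl (x + 1)]

lemma one_le_crossTime (hl : ∀ j, 0 ≤ ℓ j ∧ ℓ j ≤ 1 / 4) (x : ℕ) : 1 ≤ crossTime ℓ x := by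
  induction x with
  | zero => exact le_rfl
  | succ x ih =>
    have h := hl (x + 1)
    nlinarith [one_sub_mul_crossTime_succ hl x]

lemma crossTime_le_two (hl : ∀ j, 0 ≤ ℓ j ∧ ℓ j ≤ 1 / 4) (x : ℕ) : crossTime ℓ x ≤ 2 := by
  induction x with
  | zero => norm_num [crossTime]
  | succ x ih =>
    have h := hl (x + 1)
    nlinarith [one_sub_mul_crossTime_succ hl x]

lemma hitTime_succ (ℓ : ℕ → ℝ) (x : ℕ) : hitTime ℓ (x + 1) = hitTime ℓ x + crossTime ℓ x :=
  Finset.sum_range_succ _ _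

lemma hitTime_nonneg (hl : ∀ j, 0 ≤ ℓ j ∧ ℓ j ≤ 1 / 4) (x : ℕ) : 0 ≤ hitTime ℓ x :=
  Finset.sum_nonneg fun j _ => zero_le_one.trans (one_le_crossTime hl j)

/-- On a set of lengths where the backtracking probability is `a < 1 / 4`, the chain crosses faster
than in time `2`, the limiting crossing time for the backtracking probability `1 / 4`. -/
lemma hitTime_add_le (hl : ∀ j, 0 ≤ ℓ j ∧ ℓ j ≤ 1 / 4) {a : ℝ} {x : ℕ} {S : Finset ℕ}
    (hS : S ⊆ Finset.Ico 1 x) (ha : ∀ j ∈ S, ℓ j = a) :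
    hitTime ℓ x + (1 - 4 * a) / (1 - a) * S.card ≤ 2 * x := by
  have hsub : S ⊆ Finset.range x := fun j hj => by
    have := Finset.mem_Ico.1 (hS hj); exact Finset.mem_range.2 this.2
  have h : ∑ _j ∈ S, (1 - 4 * a) / (1 - a) ≤ ∑ j ∈ Finset.range x, (2 - crossTime ℓ j) := by
    refine (Finset.sum_le_sum fun j hj => ?_).trans (Finset.sum_le_sum_of_subset_of_nonneg hsub
      fun j _ _ => sub_nonneg.2 (crossTime_le_two hl j))
    obtain ⟨i, rfl⟩ := Nat.exists_eq_succ_of_ne_zero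
      (show j ≠ 0 by have := Finset.mem_Ico.1 (hS hj); omega)
    have h1 := one_sub_mul_crossTime_succ hl i
    have h2 := crossTime_le_two hl i
    have h3 := hl (i + 1)
    rw [Nat.succ_eq_add_one] at hj ⊢
    rw [ha _ hj] at h1 h3
    rw [div_le_iff₀ (by linarith)]
    nlinarith
  rw [Finset.sum_const, nsmul_eq_mul, Finset.sum_sub_distrib] at h
  simp only [Finset.sum_const, Finset.card_range, nsmul_eq_mul] at h
  rw [hitTime]
  linarith

/-- For the constant backtracking probability `μ` the crossing times tend to `1 / (1 - 2 μ)`, and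
the difference decays by a factor `μ / (1 - μ) ≤ 1 / 3` at each step. So hitting times are linear
with slope `1 / (1 - 2 μ)` up to a multiple of the number of exceptional lengths. -/
lemma abs_hitTime_sub_le (hl : ∀ j, 0 ≤ ℓ j ∧ ℓ j ≤ 1 / 4) {μ : ℝ} (h0 : 0 ≤ μ) (h1 : μ ≤ 1 / 4)
    (x : ℕ) : |hitTime ℓ x - x / (1 - 2 * μ)| ≤
      3 / 2 * (1 + ((Finset.Icc 1 x).filter fun j => ℓ j ≠ μ).card) := by
  set c := 1 / (1 - 2 * μ) with hc
  have hcμ : c * (1 - 2 * μ) = 1 := div_mul_cancel₀ _ (by linarith)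
  have hc1 : 1 ≤ c := by nlinarith
  have hc2 : c ≤ 2 := by nlinarith
  set e : ℕ → ℝ := fun j => |crossTime ℓ j - c| with he
  have he1 : ∀ j, e j ≤ 1 := fun j => abs_le.2
    ⟨by linarith [one_le_crossTime hl j], by linarith [crossTime_le_two hl j]⟩
  have hstep : ∀ j, ℓ (j + 1) = μ → e (j + 1) ≤ e j / 3 := fun j hj => by
    have h2 := one_sub_mul_crossTime_succ hl j
    rw [hj] at h2
    have h3 : (1 - μ) * (crossTime ℓ (j + 1) - c) = μ * (crossTime ℓ j - c) := by
      linear_combination h2 - hcμ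
    have h4 := congrArg abs h3
    rw [abs_mul, abs_mul, abs_of_nonneg h0, abs_of_nonneg (show 0 ≤ 1 - μ by linarith)] at h4
    change (1 - μ) * e (j + 1) = μ * e j at h4
    have h5 : 0 ≤ e j := abs_nonneg _
    have h6 : 0 ≤ e (j + 1) := abs_nonneg _
    nlinarith
  -- The extra term `e x / 2` pays for the geometric decay after an exceptional length.
  have hT : ∀ x, ∑ j ∈ Finset.range (x + 1), e j + e x / 2 ≤
      3 / 2 * (1 + ((Finset.Icc 1 x).filter fun j => ℓ j ≠ μ).card) := by
    intro x
    induction x with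
    | zero => simp only [Finset.sum_range_one, zero_add]; norm_num; linarith [he1 0]
    | succ x ih =>
      rw [Finset.sum_range_succ, ← Finset.insert_Icc_right_eq_Icc_add_one (by omega),
        Finset.filter_insert]
      by_cases hx : ℓ (x + 1) = μ
      · rw [if_neg (by simpa using hx)]
        linarith [hstep x hx]
      · rw [if_pos hx, Finset.card_insert_of_notMem (by simp)]
        push_cast
        have : 0 ≤ e x := abs_nonneg _
        linarith [he1 (x + 1)]
  have hx : hitTime ℓ x - x / (1 - 2 * μ) = ∑ j ∈ Finset.range x, (crossTime ℓ j - c) := by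
    rw [hitTime, Finset.sum_sub_distrib, hc]
    simp [div_eq_mul_inv]
  rw [hx]
  refine (Finset.abs_sum_le_sum_abs _ _).trans (le_trans ?_ (hT x))
  rw [Finset.sum_range_succ]
  have : 0 ≤ e x := abs_nonneg _
  linarith

/-! ### The hitting time martingale -/

lemma avg_hitTime (hl : ∀ j, 0 ≤ ℓ j ∧ ℓ j ≤ 1 / 4) :
    avg (fun g => ℓ g.norm) (fun h => hitTime ℓ h.norm) = fun g => hitTime ℓ g.norm + 1 := by
  funext g
  by_cases hg : g = 1
  · subst hg
    rw [avg_norm_one]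
    simp [hitTime, crossTime]
  · rw [avg_norm_of_ne_one _ _ hg]
    obtain ⟨x, hx⟩ := Nat.exists_eq_succ_of_ne_zero (mt FreeGroup.norm_eq_zero.1 hg)
    rw [hx, Nat.succ_eq_add_one, Nat.add_sub_cancel, hitTime_succ ℓ (x + 1), hitTime_succ ℓ x]
    linear_combination one_sub_mul_crossTime_succ hl x

/-- `F(|w_n|) - n` is a martingale, where `F` is the hitting time. -/
lemma iterate_avg_hitTime (hl : ∀ j, 0 ≤ ℓ j ∧ ℓ j ≤ 1 / 4) (n : ℕ) (p : F2) :
    (avg fun g => ℓ g.norm)^[n] (fun h => hitTime ℓ h.norm) p = hitTime ℓ p.norm + n := by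
  induction n with
  | zero => simp
  | succ n ih =>
    rw [Function.iterate_succ_apply, avg_hitTime hl, iterate_avg_add, ih, iterate_avg_const]
    push_cast; ring

lemma avg_sq_hitTime_le (hl : ∀ j, 0 ≤ ℓ j ∧ ℓ j ≤ 1 / 4) (c : ℝ) (g : F2) :
    avg (fun g => ℓ g.norm) (fun h => (hitTime ℓ h.norm - c) ^ 2) g ≤
      (hitTime ℓ g.norm - (c - 1)) ^ 2 + 9 := by
  by_cases hg : g = 1
  · subst hg
    rw [avg_norm_one _ fun x => (hitTime ℓ x - c) ^ 2]
    simp only [hitTime, FreeGroup.norm_one, Finset.sum_range_one, Finset.range_zero,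
      Finset.sum_empty, crossTime]
    nlinarith
  · rw [avg_norm_of_ne_one _ (fun x => (hitTime ℓ x - c) ^ 2) hg]
    obtain ⟨x, hx⟩ := Nat.exists_eq_succ_of_ne_zero (mt FreeGroup.norm_eq_zero.1 hg)
    rw [hx, Nat.succ_eq_add_one, Nat.add_sub_cancel, hitTime_succ ℓ (x + 1), hitTime_succ ℓ x]
    have h := one_sub_mul_crossTime_succ hl x
    have h1 := hl (x + 1)
    have h2 := one_le_crossTime hl x
    have h3 := crossTime_le_two hl x
    have h4 := one_le_crossTime hl (x + 1)
    have h5 := crossTime_le_two hl (x + 1)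
    set q := ℓ (x + 1)
    set D := crossTime ℓ x
    set D' := crossTime ℓ (x + 1)
    set u := hitTime ℓ x + D - (c - 1) with hu
    have e : q * (hitTime ℓ x - c) ^ 2 + (1 - q) * (hitTime ℓ x + D + D' - c) ^ 2 =
        u ^ 2 + (q * (D + 1) ^ 2 + (1 - q) * (D' - 1) ^ 2) := by
      rw [hu]
      linear_combination 2 * (hitTime ℓ x + D - (c - 1)) * h
    rw [e]
    have h6 : (D + 1) ^ 2 ≤ 9 := by nlinarith
    have h7 : (D' - 1) ^ 2 ≤ 9 := by nlinarith
    nlinarith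

lemma iterate_avg_sq_hitTime_le (hl : ∀ j, 0 ≤ ℓ j ∧ ℓ j ≤ 1 / 4) (c : ℝ) (n : ℕ) (p : F2) :
    (avg fun g => ℓ g.norm)^[n] (fun h => (hitTime ℓ h.norm - c) ^ 2) p ≤
      (hitTime ℓ p.norm + n - c) ^ 2 + 9 * n := by
  have hl' : ∀ g : F2, 0 ≤ ℓ g.norm ∧ ℓ g.norm ≤ 1 := fun g =>
    ⟨(hl _).1, by linarith [(hl g.norm).2]⟩
  induction n generalizing c with
  | zero => simp
  | succ n ih =>
    rw [Function.iterate_succ_apply]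
    refine (iterate_avg_mono hl' n p fun g _ => avg_sq_hitTime_le hl c g).trans ?_
    rw [iterate_avg_add, iterate_avg_const]
    have := ih (c - 1)
    push_cast
    rw [show hitTime ℓ p.norm + (n + 1) - c = hitTime ℓ p.norm + n - (c - 1) by ring]
    linarith

/-! ### Drift -/

lemma IsBacktrackingChain.hasDrift_iff {lam : F2 → ℝ} {P : F2 → PMF F2}
    (hP : IsBacktrackingChain lam P) (p : F2) (L : ℝ≥0) :
    HasDrift P p L ↔
      Tendsto (fun n : ℕ => (avg lam)^[n] (fun h => (wordDist p h : ℝ)) p / n) atTop (𝓝 (L : ℝ)) := by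
  have h0 : ∀ n : ℕ, 0 ≤ (avg lam)^[n] (fun h => (wordDist p h : ℝ)) p / n := fun n =>
    div_nonneg (iterate_avg_nonneg hP.1 (fun _ => Nat.cast_nonneg _) n p) (Nat.cast_nonneg _)
  have he : (fun n : ℕ => expectedDist P p n / (n : ℝ≥0∞)) =ᶠ[atTop]
      fun n : ℕ => ENNReal.ofReal ((avg lam)^[n] (fun h => (wordDist p h : ℝ)) p / n) := by
    filter_upwards [eventually_gt_atTop 0] with n hn
    rw [ENNReal.ofReal_div_of_pos (by exact_mod_cast hn), ENNReal.ofReal_natCast,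
      ← hP.tsum_stepLaw fun _ => Nat.cast_nonneg _]
    simp [expectedDist]
  rw [HasDrift, tendsto_congr' he, ← ENNReal.ofReal_coe_nnreal]
  refine ⟨fun h => ?_, fun h => ENNReal.tendsto_ofReal h⟩
  have := (ENNReal.tendsto_toReal ENNReal.ofReal_ne_top).comp h
  exact (this.congr fun n => ENNReal.toReal_ofReal (h0 n)).trans
    (congrArg 𝓝 (ENNReal.toReal_ofReal L.2)).le

/-- If all but `C` of the relevant backtracking probabilities equal `μ`, then the expected distance
at time `n` differs from `(1 - 2 μ) n` by a multiple of `1 + C`. -/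
lemma abs_expected_wordDist_sub_le (hl : ∀ j, 0 ≤ ℓ j ∧ ℓ j ≤ 1 / 4) {μ : ℝ} (h0 : 0 ≤ μ)
    (h1 : μ ≤ 1 / 4) (p : F2) (n : ℕ) {C : ℝ}
    (hC : ((Finset.Icc 1 (p.norm + n)).filter fun j => ℓ j ≠ μ).card ≤ C) :
    |(avg fun g => ℓ g.norm)^[n] (fun h => (wordDist p h : ℝ)) p - (1 - 2 * μ) * n| ≤
      3 * p.norm + 3 / 2 * (1 + C) := by
  have hl' : ∀ g : F2, 0 ≤ ℓ g.norm ∧ ℓ g.norm ≤ 1 := fun g =>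
    ⟨(hl _).1, by linarith [(hl g.norm).2]⟩
  have hpos : 0 < 1 - 2 * μ := by linarith
  set K : ℝ := p.norm + 3 / 2 * (1 + C) with hK
  have hpt : ∀ h : F2, h.norm ≤ p.norm + n →
      |(wordDist p h : ℝ) - (1 - 2 * μ) * hitTime ℓ h.norm| ≤ K := fun h hh => by
    have a1 := abs_hitTime_sub_le hl h0 h1 h.norm
    have a2 : ((Finset.Icc 1 h.norm).filter fun j => ℓ j ≠ μ).card ≤ C := le_trans (by
      exact_mod_cast Finset.card_le_card (Finset.filter_subset_filter _
        (Finset.Icc_subset_Icc_right hh))) hC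
    have a3 : (h.norm : ℝ) ≤ wordDist p h + p.norm := by exact_mod_cast norm_le_wordDist_add p h
    have a4 : (wordDist p h : ℝ) ≤ h.norm + p.norm := by exact_mod_cast wordDist_le_norm_add p h
    have a5 : |(h.norm : ℝ) - (1 - 2 * μ) * hitTime ℓ h.norm| ≤ 3 / 2 * (1 + C) := by
      have e : (h.norm : ℝ) - (1 - 2 * μ) * hitTime ℓ h.norm =
          -((1 - 2 * μ) * (hitTime ℓ h.norm - h.norm / (1 - 2 * μ))) := by
        field_simp; ring
      rw [e, abs_neg, abs_mul, abs_of_pos hpos]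
      nlinarith [abs_nonneg (hitTime ℓ h.norm - h.norm / (1 - 2 * μ))]
    rw [abs_le] at a5 ⊢
    constructor <;> linarith
  have hF : hitTime ℓ p.norm ≤ 2 * p.norm := by
    simpa using hitTime_add_le hl (a := 0) (Finset.empty_subset (Finset.Ico 1 p.norm))
  have hF0 := hitTime_nonneg hl p.norm
  have hup := iterate_avg_mono hl' n p (f₁ := fun h => (wordDist p h : ℝ))
    (f₂ := fun h => (1 - 2 * μ) * hitTime ℓ h.norm + K)
    fun g hg => by linarith [(abs_le.1 (hpt g hg)).2]
  have hlo := iterate_avg_mono hl' n p (f₂ := fun h => (wordDist p h : ℝ))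
    (f₁ := fun h => (1 - 2 * μ) * hitTime ℓ h.norm + -K)
    fun g hg => by linarith [(abs_le.1 (hpt g hg)).1]
  rw [iterate_avg_add, iterate_avg_const_mul, iterate_avg_const, iterate_avg_hitTime hl]
    at hup hlo
  rw [abs_le]
  constructor <;> nlinarith
end

/-! ### Alternating annuli: no drift -/

lemma alternatingProb_mem {a : ℝ} (h0 : 0 < a) (h1 : a < 1 / 4) (j : ℕ) :
    a / 2 ≤ alternatingProb a j ∧ alternatingProb a j ≤ 1 / 4 := by
  unfold alternatingProb
  split_ifs <;> constructor <;> linarith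

lemma alternatingProb_of_even {a : ℝ} {t j : ℕ} (ht : Even t) (h1 : 2 ^ t ^ 2 < j)
    (h2 : j ≤ 2 ^ (t + 1) ^ 2) : alternatingProb a j = a := by
  obtain ⟨k, rfl⟩ := ht
  rw [← two_mul] at h1 h2
  exact if_pos ⟨k, h1, h2⟩

lemma alternatingProb_of_odd {a : ℝ} {t j : ℕ} (ht : Odd t) (h1 : 2 ^ t ^ 2 < j)
    (h2 : j ≤ 2 ^ (t + 1) ^ 2) : alternatingProb a j = a / 2 := by
  refine if_neg ?_
  rintro ⟨k, h3, h4⟩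
  have e1 : (2 * k) ^ 2 < (t + 1) ^ 2 :=
    (Nat.pow_lt_pow_iff_right (by norm_num : 1 < 2)).1 (h3.trans_le h2)
  have e2 : t ^ 2 < (2 * k + 1) ^ 2 :=
    (Nat.pow_lt_pow_iff_right (by norm_num : 1 < 2)).1 (h1.trans_le h4)
  have e3 := lt_of_pow_lt_pow_left₀ 2 (by omega) e1
  have e4 := lt_of_pow_lt_pow_left₀ 2 (by omega) e2
  obtain ⟨m, rfl⟩ := ht
  omega

/-- At time `2 ^ (t ^ 2 + 2 t)` the chain has spent most of the time in the annulus
`(2 ^ t ^ 2, 2 ^ (t + 1) ^ 2]`. -/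
lemma abs_expected_wordDist_div_sub_le {ℓ : ℕ → ℝ} (hl : ∀ j, 0 ≤ ℓ j ∧ ℓ j ≤ 1 / 4) {μ : ℝ}
    (h0 : 0 ≤ μ) (h1 : μ ≤ 1 / 4) (p : F2) {t : ℕ} (hp : p.norm ≤ t)
    (hμ : ∀ j, 2 ^ t ^ 2 < j → j ≤ 2 ^ (t + 1) ^ 2 → ℓ j = μ) :
    |(avg fun g => ℓ g.norm)^[2 ^ (t ^ 2 + 2 * t)] (fun h => (wordDist p h : ℝ)) p /
        (2 ^ (t ^ 2 + 2 * t) : ℕ) - (1 - 2 * μ)| ≤ (3 * p.norm + 3) * (1 / 4) ^ t := by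
  set n := 2 ^ (t ^ 2 + 2 * t) with hn
  have hn2 : 2 ^ (t + 1) ^ 2 = 2 * n := by rw [hn, ← pow_succ']; congr 1; ring
  have htn : t ≤ n := Nat.lt_two_pow_self.le.trans
    (Nat.pow_le_pow_right (by norm_num) (by nlinarith))
  have hn4 : (n : ℝ) = 2 ^ t ^ 2 * 4 ^ t := by
    rw [hn, pow_add, pow_mul]; push_cast; norm_num
  have hcard : ((Finset.Icc 1 (p.norm + n)).filter fun j => ℓ j ≠ μ).card ≤ (2 : ℝ) ^ t ^ 2 := by
    have : (Finset.Icc 1 (p.norm + n)).filter (fun j => ℓ j ≠ μ) ⊆ Finset.Icc 1 (2 ^ t ^ 2) := by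
      intro j hj
      simp only [Finset.mem_filter, Finset.mem_Icc] at hj ⊢
      refine ⟨hj.1.1, ?_⟩
      by_contra hlt
      exact hj.2 (hμ j (not_le.1 hlt) (by omega))
    exact_mod_cast (Finset.card_le_card this).trans (by simp)
  have h := abs_expected_wordDist_sub_le hl h0 h1 p n hcard
  have hnpos : (0 : ℝ) < n := by rw [hn4]; positivity
  have h2 : (1 : ℝ) ≤ 2 ^ t ^ 2 := one_le_pow₀ (by norm_num)
  have hq : ((1 : ℝ) / 4) ^ t * n = 2 ^ t ^ 2 := by
    rw [hn4, one_div, inv_pow]; field_simp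
  rw [← mul_le_mul_iff_left₀ hnpos, ← abs_of_pos hnpos, ← abs_mul, abs_of_pos hnpos, sub_mul,
    div_mul_cancel₀ _ hnpos.ne', mul_assoc, hq]
  refine h.trans ?_
  have : (0 : ℝ) ≤ p.norm := Nat.cast_nonneg _
  nlinarith

theorem not_hasDrift_alternating {a : ℝ} (h0 : 0 < a) (h1 : a < 1 / 4) {P : F2 → PMF F2}
    (hP : IsBacktrackingChain (fun g => alternatingProb a g.norm) P) (p : F2) (L : ℝ≥0) :
    ¬ HasDrift P p L := by
  rw [hP.hasDrift_iff]
  intro hL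
  have hl : ∀ j, 0 ≤ alternatingProb a j ∧ alternatingProb a j ≤ 1 / 4 := fun j =>
    ⟨by linarith [(alternatingProb_mem h0 h1 j).1], (alternatingProb_mem h0 h1 j).2⟩
  have key : ∀ (μ : ℝ) (s : ℕ → ℕ), 0 ≤ μ → μ ≤ 1 / 4 → StrictMono s →
      (∀ k j, 2 ^ s k ^ 2 < j → j ≤ 2 ^ (s k + 1) ^ 2 → alternatingProb a j = μ) →
      (L : ℝ) = 1 - 2 * μ := by
    intro μ s hμ0 hμ1 hs hμ
    have hsub : Tendsto (fun k => 2 ^ (s k ^ 2 + 2 * s k)) atTop (atTop : Filter ℕ) :=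
      (tendsto_pow_atTop_atTop_of_one_lt one_lt_two).comp
        (tendsto_atTop_mono (fun k => show k ≤ _ by nlinarith [hs.le_apply (x := k)]) tendsto_id)
    refine tendsto_nhds_unique (hL.comp hsub) ?_
    rw [tendsto_iff_dist_tendsto_zero]
    have hlim : Tendsto (fun k => (3 * (p.norm : ℝ) + 3) * (1 / 4) ^ s k) atTop (𝓝 0) := by
      have := ((tendsto_pow_atTop_nhds_zero_of_lt_one (r := (1 / 4 : ℝ)) (by norm_num)
        (by norm_num)).comp hs.tendsto_atTop).const_mul (3 * (p.norm : ℝ) + 3)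
      simpa using this
    refine squeeze_zero' (Eventually.of_forall fun _ => dist_nonneg) ?_ hlim
    filter_upwards [hs.tendsto_atTop.eventually_ge_atTop p.norm] with k hk
    exact abs_expected_wordDist_div_sub_le hl hμ0 hμ1 p hk (hμ k)
  have e1 := key a (fun k => 2 * k) h0.le h1.le (fun x y h => by dsimp only; omega)
    fun k j => alternatingProb_of_even (even_two_mul k)
  have e2 := key (a / 2) (fun k => 2 * k + 1) (by linarith) (by linarith)
    (fun x y h => by dsimp only; omega) fun k j => alternatingProb_of_odd (odd_two_mul_add_one k)
  linarith

/-! ### Sparse annuli: the drift -/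

lemma sparseProb_mem {a : ℝ} (h1 : a < 1 / 4) (N₁ j : ℕ) :
    a ≤ sparseProb N₁ a j ∧ sparseProb N₁ a j ≤ 1 / 4 := by
  unfold sparseProb
  split_ifs <;> constructor <;> linarith

lemma sum_rpow_four_pow_mul_le (N₁ n : ℕ) :
    ∑ k ∈ Finset.range (n + 1), ((4 ^ k * N₁ : ℕ) : ℝ) ^ (5 / 6 : ℝ) ≤
      2 * ((4 ^ n * N₁ : ℕ) : ℝ) ^ (5 / 6 : ℝ) := by
  induction n with
  | zero =>
    have : (0 : ℝ) ≤ ((4 ^ 0 * N₁ : ℕ) : ℝ) ^ (5 / 6 : ℝ) := by positivity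
    rw [Finset.sum_range_one]; linarith
  | succ n ih =>
    rw [Finset.sum_range_succ]
    have h2 : (2 : ℝ) ≤ 4 ^ (5 / 6 : ℝ) := by
      have h4 : (4 : ℝ) ^ (1 / 2 : ℝ) = 2 := by
        rw [← Real.sqrt_eq_rpow]
        exact (Real.sqrt_eq_iff_mul_self_eq (by norm_num) (by norm_num)).2 (by norm_num)
      rw [← h4]
      exact Real.rpow_le_rpow_of_exponent_le (by norm_num) (by norm_num)
    have e : ((4 ^ (n + 1) * N₁ : ℕ) : ℝ) ^ (5 / 6 : ℝ) =
        4 ^ (5 / 6 : ℝ) * ((4 ^ n * N₁ : ℕ) : ℝ) ^ (5 / 6 : ℝ) := by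
      rw [← Real.mul_rpow (by norm_num) (by positivity)]
      congr 1
      push_cast; ring
    have : (0 : ℝ) ≤ ((4 ^ n * N₁ : ℕ) : ℝ) ^ (5 / 6 : ℝ) := by positivity
    rw [e] at *
    nlinarith

lemma card_Icc_ceil_floor_le {x r : ℝ} (hr : 1 ≤ r) (hx : 0 ≤ x + r) :
    ((Finset.Icc ⌈x - r⌉₊ ⌊x + r⌋₊).card : ℝ) ≤ 3 * r := by
  rw [Nat.card_Icc]
  have h1 := Nat.le_ceil (x - r)
  have h2 := Nat.floor_le hx
  rcases le_total ⌈x - r⌉₊ (⌊x + r⌋₊ + 1) with h | h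
  · rw [Nat.cast_sub h]; push_cast; linarith
  · rw [Nat.sub_eq_zero_of_le h]; push_cast; linarith

open Classical in
/-- As `N₁ > 2 ^ 6`, the annuli around `N / 2` stay at distance at least `η N` from the identity.
So an annulus meeting `[1, x]` has `N ≤ x / η`, and the largest of these dominates their sum. -/
lemma exists_card_sparseAnnuli_le {N₁ : ℕ} (hN : 2 ^ 6 < N₁) :
    ∃ η : ℝ, 0 < η ∧ ∀ x : ℕ, (((Finset.Icc 1 x).filter (· ∈ sparseAnnuli N₁)).card : ℝ) ≤
      6 * (x / η) ^ (5 / 6 : ℝ) := by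
  have hN' : (2 : ℝ) ^ 6 < N₁ := by exact_mod_cast hN
  have hNpos : (0 : ℝ) < N₁ := lt_trans (by norm_num) hN'
  have hroot : (2 : ℝ) < (N₁ : ℝ) ^ (1 / 6 : ℝ) := by
    have := Real.rpow_lt_rpow (z := 1 / 6) (by norm_num) hN' (by norm_num)
    rwa [← Real.rpow_natCast, ← Real.rpow_mul (by norm_num), Nat.cast_ofNat,
      show (6 : ℝ) * (1 / 6) = 1 by norm_num, Real.rpow_one] at this
  set η : ℝ := 1 / 2 - ((N₁ : ℝ) ^ (1 / 6 : ℝ))⁻¹ with hη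
  have hηpos : 0 < η := by
    rw [hη, sub_pos, one_div 2]
    exact inv_strictAnti₀ (by norm_num) hroot
  refine ⟨η, hηpos, fun x => ?_⟩
  set X : ℝ := x / η with hX
  have hX0 : 0 ≤ X := by positivity
  have hNk : ∀ k : ℕ, (N₁ : ℝ) ≤ (4 ^ k * N₁ : ℕ) := fun k => by
    exact_mod_cast Nat.le_mul_of_pos_left _ (by positivity)
  have hfar : ∀ k : ℕ, η * (4 ^ k * N₁ : ℕ) ≤
      ((4 ^ k * N₁ : ℕ) : ℝ) / 2 - ((4 ^ k * N₁ : ℕ) : ℝ) ^ (5 / 6 : ℝ) := fun k => by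
    set N : ℝ := ((4 ^ k * N₁ : ℕ) : ℝ)
    have hk : (N₁ : ℝ) ≤ N := hNk k
    have hNp : 0 < N := hNpos.trans_le hk
    have e1 : N ^ (5 / 6 : ℝ) * N ^ (1 / 6 : ℝ) = N := by
      rw [← Real.rpow_add hNp]; norm_num
    have e2 : (N₁ : ℝ) ^ (1 / 6 : ℝ) ≤ N ^ (1 / 6 : ℝ) :=
      Real.rpow_le_rpow hNpos.le hk (by norm_num)
    have e3 : N ^ (5 / 6 : ℝ) ≤ N * ((N₁ : ℝ) ^ (1 / 6 : ℝ))⁻¹ := by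
      rw [← div_eq_mul_inv, le_div_iff₀ (by linarith)]
      have : 0 ≤ N ^ (5 / 6 : ℝ) := by positivity
      nlinarith
    rw [hη]; linarith
  set T := (Finset.range (⌊X⌋₊ + 1)).filter fun k => ((4 ^ k * N₁ : ℕ) : ℝ) ≤ X with hT
  have hsub : (Finset.Icc 1 x).filter (· ∈ sparseAnnuli N₁) ⊆ T.biUnion fun k =>
      Finset.Icc ⌈((4 ^ k * N₁ : ℕ) : ℝ) / 2 - ((4 ^ k * N₁ : ℕ) : ℝ) ^ (5 / 6 : ℝ)⌉₊
        ⌊((4 ^ k * N₁ : ℕ) : ℝ) / 2 + ((4 ^ k * N₁ : ℕ) : ℝ) ^ (5 / 6 : ℝ)⌋₊ := by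
    intro j hj
    obtain ⟨hjx, k, hk1, hk2⟩ := Finset.mem_filter.1 hj
    have hjx' : (j : ℝ) ≤ x := by exact_mod_cast (Finset.mem_Icc.1 hjx).2
    have hkX : ((4 ^ k * N₁ : ℕ) : ℝ) ≤ X := by
      rw [hX, le_div_iff₀ hηpos, mul_comm]
      linarith [hfar k]
    refine Finset.mem_biUnion.2 ⟨k, Finset.mem_filter.2 ⟨Finset.mem_range.2 ?_, hkX⟩,
      Finset.mem_Icc.2 ⟨Nat.ceil_le.2 hk1, Nat.le_floor hk2⟩⟩
    have h1 : k < 4 ^ k := Nat.lt_pow_self (by norm_num)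
    have h2 : 4 ^ k ≤ 4 ^ k * N₁ := Nat.le_mul_of_pos_right _ (by omega)
    have h3 : 4 ^ k * N₁ ≤ ⌊X⌋₊ := Nat.le_floor hkX
    omega
  have hcard : (((Finset.Icc 1 x).filter (· ∈ sparseAnnuli N₁)).card : ℝ) ≤
      ∑ k ∈ T, 3 * ((4 ^ k * N₁ : ℕ) : ℝ) ^ (5 / 6 : ℝ) := by
    refine (Nat.cast_le.2 ((Finset.card_le_card hsub).trans Finset.card_biUnion_le)).trans ?_
    rw [Nat.cast_sum]
    refine Finset.sum_le_sum fun k _ => ?_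
    have := card_Icc_ceil_floor_le (x := ((4 ^ k * N₁ : ℕ) : ℝ) / 2)
      (r := ((4 ^ k * N₁ : ℕ) : ℝ) ^ (5 / 6 : ℝ))
      (Real.one_le_rpow (le_trans (by linarith) (hNk k)) (by norm_num)) (by positivity)
    exact this
  refine hcard.trans ?_
  rw [← Finset.mul_sum]
  rcases T.eq_empty_or_nonempty with hTe | hTn
  · rw [hTe, Finset.sum_empty, mul_zero]; positivity
  · have h1 : T ⊆ Finset.range (T.max' hTn + 1) := fun k hk =>
      Finset.mem_range.2 (Nat.lt_succ_of_le (T.le_max' k hk))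
    have h2 := (Finset.sum_le_sum_of_subset_of_nonneg h1 (f := fun k =>
      ((4 ^ k * N₁ : ℕ) : ℝ) ^ (5 / 6 : ℝ)) fun _ _ _ => by positivity).trans
      (sum_rpow_four_pow_mul_le N₁ _)
    have h3 : ((4 ^ T.max' hTn * N₁ : ℕ) : ℝ) ^ (5 / 6 : ℝ) ≤ X ^ (5 / 6 : ℝ) :=
      Real.rpow_le_rpow (by positivity) (Finset.mem_filter.1 (T.max'_mem hTn)).2 (by norm_num)
    linarith

theorem hasDrift_sparse {N₁ : ℕ} {a : ℝ} (hN : 2 ^ 6 < N₁) (h0 : 0 < a) (h1 : a < 1 / 4)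
    {P : F2 → PMF F2} (hP : IsBacktrackingChain (fun g => sparseProb N₁ a g.norm) P) (p : F2) :
    HasDrift P p (1 / 2) := by
  classical
  rw [hP.hasDrift_iff]
  have hl : ∀ j, 0 ≤ sparseProb N₁ a j ∧ sparseProb N₁ a j ≤ 1 / 4 := fun j =>
    ⟨by linarith [(sparseProb_mem h1 N₁ j).1], (sparseProb_mem h1 N₁ j).2⟩
  obtain ⟨η, hη, hcard⟩ := exists_card_sparseAnnuli_le hN
  rw [tendsto_iff_dist_tendsto_zero]
  set C : ℝ := 9 * (2 / η) ^ (5 / 6 : ℝ)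
  have hlim : Tendsto (fun n : ℕ => (3 * (p.norm : ℝ) + 3 / 2) / n + C * (n : ℝ) ^ (-(1 / 6) : ℝ))
      atTop (𝓝 0) := by
    have t1 : Tendsto (fun n : ℕ => (3 * (p.norm : ℝ) + 3 / 2) / n) atTop (𝓝 0) :=
      tendsto_const_div_atTop_nhds_zero_nat _
    have t2 := ((tendsto_rpow_neg_atTop (y := 1 / 6) (by norm_num)).comp
      tendsto_natCast_atTop_atTop).const_mul C
    simpa using t1.add t2
  refine squeeze_zero' (Eventually.of_forall fun _ => dist_nonneg) ?_ hlim
  filter_upwards [eventually_gt_atTop 0, eventually_ge_atTop p.norm] with n hn hpn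
  have hnpos : (0 : ℝ) < n := by exact_mod_cast hn
  have hC : ((Finset.Icc 1 (p.norm + n)).filter fun j => sparseProb N₁ a j ≠ 1 / 4).card ≤
      2 / 3 * C * (n : ℝ) ^ (5 / 6 : ℝ) := by
    have hsub : (Finset.Icc 1 (p.norm + n)).filter (fun j => sparseProb N₁ a j ≠ 1 / 4) ⊆
        (Finset.Icc 1 (p.norm + n)).filter (· ∈ sparseAnnuli N₁) :=
      Finset.monotone_filter_right _ fun j _ hj => by
        by_contra hc
        exact hj (if_neg hc)
    refine le_trans (by exact_mod_cast Finset.card_le_card hsub) ((hcard _).trans ?_)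
    have e : 2 / 3 * C * (n : ℝ) ^ (5 / 6 : ℝ) = 6 * (2 / η * n) ^ (5 / 6 : ℝ) := by
      rw [Real.mul_rpow (by positivity) hnpos.le]; ring
    rw [e]
    have hpn' : (p.norm : ℝ) ≤ n := by exact_mod_cast hpn
    have : ((p.norm + n : ℕ) : ℝ) / η ≤ 2 / η * n := by
      rw [div_mul_eq_mul_div]
      gcongr
      push_cast; linarith
    gcongr
  have h := abs_expected_wordDist_sub_le hl (by norm_num) le_rfl p n hC
  have e1 : (n : ℝ) ^ (-(1 / 6) : ℝ) * n = (n : ℝ) ^ (5 / 6 : ℝ) := by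
    rw [← Real.rpow_add_one hnpos.ne']; norm_num
  set E := (avg fun g => sparseProb N₁ a g.norm)^[n] (fun h => (wordDist p h : ℝ)) p
  have e2 : E / n - ((1 / 2 : ℝ≥0) : ℝ) = (E - (1 - 2 * (1 / 4)) * n) / n := by
    rw [sub_div, mul_div_cancel_right₀ _ hnpos.ne']
    norm_num
  rw [Real.dist_eq, e2, abs_div, abs_of_pos hnpos, div_le_iff₀ hnpos, add_mul,
    div_mul_cancel₀ _ hnpos.ne', mul_assoc, e1]
  linarith

/-! ### Sparse annuli: failure of the central limit theorem -/

/-- Each annulus speeds the chain up by an amount of order `N ^ (5 / 6)`, which at time `2 N`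
exceeds the fluctuations of order `√N`. -/
lemma eventually_sq_le_of_wordDist_lt {N₁ : ℕ} {a : ℝ} (hN : 2 ^ 6 < N₁) (h0 : 0 < a)
    (h1 : a < 1 / 4) (p : F2) {K : ℝ} (hK : 0 < K) :
    ∀ᶠ k : ℕ in atTop, ∀ h : F2, (wordDist p h : ℝ) < 4 ^ k * N₁ →
      K ^ 2 * (4 ^ k * N₁) ≤ (hitTime (sparseProb N₁ a) h.norm -
        (hitTime (sparseProb N₁ a) p.norm + 2 * (4 ^ k * N₁))) ^ 2 := by
  have hl : ∀ j, 0 ≤ sparseProb N₁ a j ∧ sparseProb N₁ a j ≤ 1 / 4 := fun j =>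
    ⟨by linarith [(sparseProb_mem h1 N₁ j).1], (sparseProb_mem h1 N₁ j).2⟩
  set δ := (1 - 4 * a) / (1 - a) with hδ
  have hδ0 : 0 < δ := div_pos (by linarith) (by linarith)
  have hN0 : 0 < N₁ := by omega
  have hlim : Tendsto (fun k : ℕ => (4 : ℝ) ^ k * N₁) atTop atTop :=
    (tendsto_pow_atTop_atTop_of_one_lt (by norm_num)).atTop_mul_const (by exact_mod_cast hN0)
  filter_upwards [((tendsto_rpow_atTop (y := 1 / 3) (by norm_num)).comp hlim).eventually_ge_atTop
      (1 + (K + 2 * p.norm) / δ), ((tendsto_rpow_atTop (y := 1 / 2) (by norm_num)).comp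
      hlim).eventually_gt_atTop (max 1 K), eventually_gt_atTop 0,
      ((tendsto_rpow_atTop (y := 1 / 6) (by norm_num)).comp hlim).eventually_gt_atTop 2]
    with k hk1 hk2 hk0 hk6 h hh
  simp only [Function.comp_apply] at hk1 hk2 hk6
  obtain ⟨M, hM⟩ : ∃ M : ℕ, 4 ^ k * N₁ = 2 * M := by
    obtain ⟨i, rfl⟩ := Nat.exists_eq_succ_of_ne_zero hk0.ne'
    exact ⟨2 * 4 ^ i * N₁, by rw [pow_succ]; ring⟩
  have hMR : (4 : ℝ) ^ k * N₁ = 2 * M := by exact_mod_cast hM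
  have hannulus : ∀ j : ℕ, ((4 : ℝ) ^ k * N₁) / 2 - (4 ^ k * N₁) ^ (5 / 6 : ℝ) ≤ j →
      (j : ℝ) ≤ (4 ^ k * N₁) / 2 → sparseProb N₁ a j = a := fun j hj1 hj2 => by
    refine if_pos ⟨k, ?_, ?_⟩
    · push_cast; exact hj1
    · push_cast
      exact hj2.trans (le_add_of_nonneg_right (by positivity))
  set N : ℝ := 4 ^ k * N₁ with hNdef
  have hNpos : 0 < N := by positivity
  have e1 : N ^ (1 / 2 : ℝ) * N ^ (1 / 2 : ℝ) = N := by rw [← Real.rpow_add hNpos]; norm_num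
  have e2 : N ^ (1 / 2 : ℝ) * N ^ (1 / 3 : ℝ) = N ^ (5 / 6 : ℝ) := by
    rw [← Real.rpow_add hNpos]; norm_num
  have e3 : N ^ (5 / 6 : ℝ) * N ^ (1 / 6 : ℝ) = N := by rw [← Real.rpow_add hNpos]; norm_num
  have hR1 : 1 < N ^ (1 / 2 : ℝ) := (le_max_left _ _).trans_lt hk2
  have hRK : K < N ^ (1 / 2 : ℝ) := (le_max_right _ _).trans_lt hk2
  have hr0 : 0 < N ^ (5 / 6 : ℝ) := by positivity
  have hrM : N ^ (5 / 6 : ℝ) < M := by nlinarith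
  set R := N ^ (1 / 2 : ℝ)
  set r := N ^ (5 / 6 : ℝ)
  set m := ⌊r⌋₊ with hm
  have hmr : (m : ℝ) ≤ r := Nat.floor_le hr0.le
  have hmr' : r < m + 1 := Nat.lt_floor_add_one r
  have hmM : m < M := by exact_mod_cast hmr.trans_lt hrM
  by_contra! hlt
  have hF0 := hitTime_nonneg hl p.norm
  -- As the martingale is not too negative, the chain has passed the annulus.
  have hF : 2 * N - K * R < hitTime (sparseProb N₁ a) h.norm := by
    have hs : K ^ 2 * N = (K * R) ^ 2 := by rw [mul_pow, sq R, e1]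
    rw [hs] at hlt
    linarith [(abs_lt_of_sq_lt_sq' hlt (by positivity)).1]
  have hle : hitTime (sparseProb N₁ a) h.norm ≤ 2 * h.norm := by
    simpa using hitTime_add_le hl (a := 0) (Finset.empty_subset (Finset.Ico 1 h.norm))
  have hMh : M ≤ h.norm := by
    have : (M : ℝ) ≤ h.norm := by nlinarith
    exact_mod_cast this
  have hgain := hitTime_add_le hl (a := a) (x := h.norm) (S := Finset.Ico (M - m) M)
    (fun j hj => by rw [Finset.mem_Ico] at hj ⊢; omega) fun j hj => by
      rw [Finset.mem_Ico] at hj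
      have b1 : (M : ℝ) ≤ j + m := by exact_mod_cast (show M ≤ j + m by omega)
      have b2 : (j : ℝ) ≤ M := by exact_mod_cast hj.2.le
      exact hannulus j (by linarith) (by linarith)
  rw [Nat.card_Ico, Nat.sub_sub_self hmM.le, ← hδ] at hgain
  have hd : (h.norm : ℝ) ≤ wordDist p h + p.norm := by exact_mod_cast norm_le_wordDist_add p h
  have hp0 : (0 : ℝ) ≤ p.norm := Nat.cast_nonneg _
  have hk1' : K + 2 * p.norm ≤ δ * (N ^ (1 / 3 : ℝ) - 1) := by
    rw [← div_le_iff₀' hδ0]; linarith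
  have hbig : (K + 2 * p.norm) * R ≤ δ * m := by
    have c1 : R * (K + 2 * p.norm) ≤ R * (δ * (N ^ (1 / 3 : ℝ) - 1)) :=
      mul_le_mul_of_nonneg_left hk1' (by linarith)
    have c2 : R * (δ * (N ^ (1 / 3 : ℝ) - 1)) = δ * (r - R) := by rw [← e2]; ring
    nlinarith
  nlinarith

lemma normalizedLaw_Iio_le {lam : F2 → ℝ} {P : F2 → PMF F2} (hP : IsBacktrackingChain lam P)
    (p : F2) {L σ : ℝ} {n : ℕ} {f : F2 → ℝ} (hf : ∀ h, 0 ≤ f h)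
    (hf1 : ∀ h, (wordDist p h : ℝ) < L * n → 1 ≤ f h) :
    (normalizedLaw P p L σ n : Measure ℝ) (Set.Iio 0) ≤ ENNReal.ofReal ((avg lam)^[n] f p) := by
  change (((stepLaw P p n).map _).toMeasure) _ ≤ _
  rw [PMF.toMeasure_apply_eq_toOuterMeasure_apply _ measurableSet_Iio,
    PMF.toOuterMeasure_map_apply, PMF.toOuterMeasure_apply, ← hP.tsum_stepLaw hf]
  refine ENNReal.tsum_le_tsum fun h => ?_
  by_cases hh : h ∈ (fun h => ((wordDist p h : ℝ) - L * n) / (σ ^ 2 * Real.sqrt n)) ⁻¹' Set.Iio 0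
  · rw [Set.indicator_of_mem hh]
    have h1 : (wordDist p h : ℝ) < L * n := by
      by_contra! hc
      have : 0 ≤ ((wordDist p h : ℝ) - L * n) / (σ ^ 2 * Real.sqrt n) :=
        div_nonneg (sub_nonneg.2 hc) (by positivity)
      exact this.not_gt hh
    exact le_mul_of_one_le_right' (ENNReal.one_le_ofReal.2 (hf1 h h1))
  · rw [Set.indicator_of_notMem hh]
    exact zero_le

theorem not_satisfiesCLT_sparse {N₁ : ℕ} {a : ℝ} (hN : 2 ^ 6 < N₁) (h0 : 0 < a)
    (h1 : a < 1 / 4) {P : F2 → PMF F2}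
    (hP : IsBacktrackingChain (fun g => sparseProb N₁ a g.norm) P) (p : F2) :
    ¬ SatisfiesCLT P p (1 / 2) := by
  rintro ⟨σ, -, hσ⟩
  have hl : ∀ j, 0 ≤ sparseProb N₁ a j ∧ sparseProb N₁ a j ≤ 1 / 4 := fun j =>
    ⟨by linarith [(sparseProb_mem h1 N₁ j).1], (sparseProb_mem h1 N₁ j).2⟩
  have hopen := ProbabilityMeasure.le_liminf_measure_open_of_tendsto hσ (isOpen_Iio (a := (0 : ℝ)))
  have hpos : 0 < gaussianReal 0 1 (Set.Iio 0) := by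
    refine pos_iff_ne_zero.2 fun hz => ?_
    have := gaussianReal_absolutelyContinuous' 0 one_ne_zero hz
    simp at this
  have hN0 : (0 : ℝ) < N₁ := by exact_mod_cast (show 0 < N₁ by omega)
  have hbound : ∀ K : ℝ, 0 < K → gaussianReal 0 1 (Set.Iio 0) ≤ ENNReal.ofReal (18 / K ^ 2) := by
    intro K hK
    refine hopen.trans (liminf_le_of_frequently_le' ?_)
    have hlim : Tendsto (fun k : ℕ => 2 * (4 ^ k * N₁)) atTop atTop :=
      tendsto_atTop_mono (fun k => by
        have h1 : k < 4 ^ k := Nat.lt_pow_self (by norm_num)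
        have h2 : 4 ^ k ≤ 4 ^ k * N₁ := Nat.le_mul_of_pos_right _ (by omega)
        simp only [id]; omega) tendsto_id
    refine hlim.frequently (Eventually.frequently ?_)
    filter_upwards [eventually_sq_le_of_wordDist_lt hN h0 h1 p hK] with k hk
    have hNk : (0 : ℝ) < 4 ^ k * N₁ := by positivity
    refine (normalizedLaw_Iio_le hP p (f := fun h => (K ^ 2 * (4 ^ k * N₁))⁻¹ *
      (hitTime (sparseProb N₁ a) h.norm -
        (hitTime (sparseProb N₁ a) p.norm + 2 * (4 ^ k * N₁))) ^ 2)
      (fun h => by positivity) fun h hh => ?_).trans (ENNReal.ofReal_le_ofReal ?_)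
    · rw [inv_mul_eq_div, one_le_div (by positivity)]
      exact hk h (by push_cast at hh; linarith)
    · rw [iterate_avg_const_mul, inv_mul_eq_div, div_le_div_iff₀ (by positivity) (by positivity)]
      have := iterate_avg_sq_hitTime_le hl
        (hitTime (sparseProb N₁ a) p.norm + 2 * (4 ^ k * N₁)) (2 * (4 ^ k * N₁)) p
      push_cast at this ⊢
      rw [sub_self] at this
      have hK2 : 0 < K ^ 2 := by positivity
      nlinarith
  have hz : Tendsto (fun K : ℝ => ENNReal.ofReal (18 / K ^ 2)) atTop (𝓝 0) := by
    rw [← ENNReal.ofReal_zero]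
    exact ENNReal.tendsto_ofReal (tendsto_const_nhds.div_atTop (tendsto_pow_atTop two_ne_zero))
  exact hpos.not_ge (ge_of_tendsto hz ((eventually_gt_atTop 0).mono hbound))

theorem theoremA :
    (∀ a : ℝ, 0 < a → a < 1 / 4 →
      ∃ P : F2 → PMF F2,
        IsBacktrackingChain (fun g => alternatingProb a g.norm) P ∧
        IsLengthHomogeneous P ∧
        IsTame P ∧
        ∀ p : F2, ¬ ∃ L : ℝ≥0, HasDrift P p L) ∧
    (∀ (N₁ : ℕ) (a : ℝ), 2 ^ 6 < N₁ → 0 < a → a < 1 / 4 →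
      ∃ P : F2 → PMF F2,
        IsBacktrackingChain (fun g => sparseProb N₁ a g.norm) P ∧
        IsLengthHomogeneous P ∧
        IsTame P ∧
        ∀ p : F2, HasDrift P p (1 / 2) ∧ ¬ SatisfiesCLT P p (1 / 2)) := by
  refine ⟨fun a h0 h1 => ?_, fun N₁ a hN h0 h1 => ?_⟩
  · have hm := alternatingProb_mem h0 h1
    obtain ⟨P, hP⟩ := exists_isBacktrackingChain (lam := fun g => alternatingProb a g.norm)
      fun g => ⟨by linarith [(hm g.norm).1], by linarith [(hm g.norm).2]⟩
    exact ⟨P, hP, ⟨_, hP, fun g₁ g₂ h => by simp only [h]⟩,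
      hP.isTame (half_pos h0) fun g => hm g.norm,
      fun p ⟨L, hL⟩ => not_hasDrift_alternating h0 h1 hP p L hL⟩
  · have hm := sparseProb_mem h1 N₁
    obtain ⟨P, hP⟩ := exists_isBacktrackingChain (lam := fun g => sparseProb N₁ a g.norm)
      fun g => ⟨by linarith [(hm g.norm).1], by linarith [(hm g.norm).2]⟩
    exact ⟨P, hP, ⟨_, hP, fun g₁ g₂ h => by simp only [h]⟩,
      hP.isTame h0 fun g => hm g.norm,
      fun p => ⟨hasDrift_sparse hN h0 h1 hP p, not_satisfiesCLT_sparse hN h0 h1 hP p⟩⟩
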